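/- Let $n\ge 6$, let $F_n$ be the free group with basis $a_1,\dots,a_n$, and for $i\neq j$ let $\lambda_{ij},\rho_{ij}\in\mathrm{Aut}(F_n)$ be the Nielsen generators: $\lambda_{ij}$ sends $a_i\mapsto a_ja_i$, $\rho_{ij}$ sends $a_i\mapsto a_ia_j$, and both fix $a_k$ for all $k\ne i$. The translation length of an isometry $\gamma$ of a non-empty metric space $X$ is $\|\gamma\|=\inf\{d(x,\gamma x)\mid x\in X\}$, and $\mathrm{Min}(\gamma)=\{x\in X\mid d(x,\gamma x)=\|\gamma\|\}$. If $\|\gamma\|=0$, then $\gamma$ is called elliptic if $\mathrm{Min}(\gamma)\ne\emptyset$ (that is, if $\gamma$ has a fixed point) and neutral parabolic if $\mathrm{Min}(\gamma)=\emptyset$. Whenever $\mathrm{Aut}(F_n)$ acts by isometries on a complete non-empty $\mathrm{CAT}(0)$ space $X$, for all $i\ne j$ the isometries of $X$ given by $\lambda_{ij}$ and $\rho_{ij}$ have translation length zero; that is, each of them is either elliptic or neutral parabolic. -/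

import Mathlib

/-! ### CAT(0) spaces -/

/-- `c` restricted to `[0, dist x y]` is a geodesic path from `x` to `y`, parametrised by
arc length: an isometric embedding of that interval starting at `x` and ending at `y`. -/
structure IsGeodesicPath {X : Type*} [MetricSpace X] (c : ℝ → X) (x y : X) : Prop where
  source : c 0 = x
  target : c (dist x y) = y
  isometric : ∀ s ∈ Set.Icc (0 : ℝ) (dist x y), ∀ t ∈ Set.Icc (0 : ℝ) (dist x y),
    dist (c s) (c t) = |s - t|

/-- A CAT(0) space: a geodesic metric space in which every geodesic triangle is at least as thin
as its comparison triangle in the Euclidean plane.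

Since vertices may be relabelled and geodesics reversed, it is enough to compare a point `c s` on
the side `[x, y]` with a point `c' t` on the side `[x, z]`; their comparison points are the points
`p`, `q` on the sides `[x', y']`, `[x', z']` of the comparison triangle at distance `s`, `t`
from `x'`. -/
structure IsCAT0 (X : Type*) [MetricSpace X] : Prop where
  exists_geodesic : ∀ x y : X, ∃ c : ℝ → X, IsGeodesicPath c x y
  thin : ∀ (x y z : X) (c c' : ℝ → X), IsGeodesicPath c x y → IsGeodesicPath c' x z →
    ∀ x' y' z' : EuclideanSpace ℝ (Fin 2),
      dist x' y' = dist x y → dist y' z' = dist y z → dist x' z' = dist x z →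
    ∀ s ∈ Set.Icc (0 : ℝ) (dist x y), ∀ t ∈ Set.Icc (0 : ℝ) (dist x z),
    ∀ p ∈ segment ℝ x' y', ∀ q ∈ segment ℝ x' z', dist x' p = s → dist x' q = t →
      dist (c s) (c' t) ≤ dist p q

/-! ### Isometries -/

/-- The translation length `inf {d(x, γ x) | x ∈ X}` of an isometry. -/
noncomputable def translationLength {X : Type*} [MetricSpace X] (γ : X ≃ᵢ X) : ℝ :=
  ⨅ x : X, dist x (γ x)

/-- `Min(γ)`, the set of points where the translation length is attained. -/
def minSet {X : Type*} [MetricSpace X] (γ : X ≃ᵢ X) : Set X :=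
  {x | dist x (γ x) = translationLength γ}

/-- An elliptic isometry: semisimple (`Min(γ)` is non-empty) with translation length zero. -/
def IsElliptic {X : Type*} [MetricSpace X] (γ : X ≃ᵢ X) : Prop :=
  (minSet γ).Nonempty ∧ translationLength γ = 0

/-- A neutral parabolic isometry: `Min(γ)` is empty and the translation length is zero. -/
def IsNeutralParabolic {X : Type*} [MetricSpace X] (γ : X ≃ᵢ X) : Prop :=
  minSet γ = ∅ ∧ translationLength γ = 0

/-- Elliptic isometries are exactly the isometries with a fixed point. -/
theorem isElliptic_iff_exists_fixed {X : Type*} [MetricSpace X] (γ : X ≃ᵢ X) :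
    IsElliptic γ ↔ ∃ x, γ x = x := by
  constructor
  · rintro ⟨⟨x, hx⟩, h0⟩
    have hx' : dist x (γ x) = translationLength γ := hx
    exact ⟨x, (dist_eq_zero.1 (hx'.trans h0)).symm⟩
  · rintro ⟨x, hx⟩
    have hd : dist x (γ x) = 0 := by rw [hx, dist_self]
    have h0 : translationLength γ = 0 := by
      apply le_antisymm
      · rw [← hd]
        exact ciInf_le ⟨0, by rintro _ ⟨y, rfl⟩; exact dist_nonneg⟩ x
      · exact Real.iInf_nonneg fun _ => dist_nonneg
    exact ⟨⟨x, hd.trans h0.symm⟩, h0⟩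

/-! ### Nielsen generators of the automorphism group of a free group -/

/-- The left Nielsen generator `λ_ij : a_i ↦ a_j a_i, a_k ↦ a_k (k ≠ i)`. -/
def leftNielsen {α : Type*} [DecidableEq α] (i j : α) (h : i ≠ j) : MulAut (FreeGroup α) :=
  MonoidHom.toMulEquiv
    (FreeGroup.lift fun k => if k = i then FreeGroup.of j * FreeGroup.of i else FreeGroup.of k)
    (FreeGroup.lift fun k => if k = i then (FreeGroup.of j)⁻¹ * FreeGroup.of i else FreeGroup.of k)
    (by
      ext k
      by_cases hk : k = i
      · simp [hk, h.symm]
      · simp [hk])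
    (by
      ext k
      by_cases hk : k = i
      · simp [hk, h.symm]
      · simp [hk])

/-- The right Nielsen generator `ρ_ij : a_i ↦ a_i a_j, a_k ↦ a_k (k ≠ i)`. -/
def rightNielsen {α : Type*} [DecidableEq α] (i j : α) (h : i ≠ j) : MulAut (FreeGroup α) :=
  MonoidHom.toMulEquiv
    (FreeGroup.lift fun k => if k = i then FreeGroup.of i * FreeGroup.of j else FreeGroup.of k)
    (FreeGroup.lift fun k => if k = i then FreeGroup.of i * (FreeGroup.of j)⁻¹ else FreeGroup.of k)
    (by
      ext k
      by_cases hk : k = i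
      · simp [hk, h.symm]
      · simp [hk])
    (by
      ext k
      by_cases hk : k = i
      · simp [hk, h.symm]
      · simp [hk])

/-! If an isometry `γ` of a CAT(0) space has positive translation length, its centralizer carries a
homomorphism to ℝ that is nonzero at `γ` (`IsCAT0.exists_centralizer_hom_ne_one`). It records how
far `g` moves a point in the direction of `γ ^ n x`, as `n → ∞`: the quadrilateral inequality makes
this additive up to `O(1/n)`, and linear growth of `dist x (γ ^ n x)` makes it nonzero at `γ`. No
axis is needed, so parabolic isometries are covered.

Homomorphisms to ℝ kill commutators, so a `γ` that is a product of commutators within its own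
centralizer has translation length zero in every action. In rank at least four `λ_ij` is such an
element (`leftNielsen_mem_commutator_centralizer`), and `ρ_ij` is conjugate to `λ_ij⁻¹`. -/

/-! ### Quadrilaterals in CAT(0) spaces -/

/-- Comparison triangles in the Euclidean plane exist. -/
theorem exists_comparison_triangle {a b c : ℝ} (ha : 0 < a) (hb : 0 ≤ b) (h₁ : a ≤ b + c)
    (h₂ : b ≤ a + c) (h₃ : c ≤ a + b) :
    ∃ x y z : EuclideanSpace ℝ (Fin 2), dist x y = a ∧ dist y z = c ∧ dist x z = b := by
  have hc : 0 ≤ c := by linarith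
  -- Law of cosines: the first coordinate of `z` when `x = 0` and `y = (a, 0)`.
  set u := (a ^ 2 + b ^ 2 - c ^ 2) / (2 * a) with hu
  have hua : 2 * a * u = a ^ 2 + b ^ 2 - c ^ 2 := by rw [hu]; field_simp
  have hub : u ^ 2 ≤ b ^ 2 := by
    refine sq_le_sq' ?_ ?_
    · rw [hu, le_div_iff₀ (by positivity)]
      nlinarith
    · rw [hu, div_le_iff₀ (by positivity)]
      nlinarith [mul_nonneg (by linarith : 0 ≤ c - a + b) (by linarith : 0 ≤ c + a - b)]
  have hs : √(b ^ 2 - u ^ 2) ^ 2 = b ^ 2 - u ^ 2 := Real.sq_sqrt (by linarith)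
  refine ⟨0, !₂[a, 0], !₂[u, √(b ^ 2 - u ^ 2)], ?_, ?_, ?_⟩ <;>
    rw [EuclideanSpace.dist_eq, Real.sqrt_eq_iff_eq_sq (by positivity) (by positivity)] <;>
    simp [Fin.sum_univ_two, Real.dist_eq, sq_abs]
  · nlinarith
  · linarith

namespace IsCAT0

variable {X : Type*} [MetricSpace X]

/-- The Bruhat–Tits (CN) inequality. -/
theorem exists_midpoint (hX : IsCAT0 X) (x y : X) :
    ∃ m : X, dist x m = dist x y / 2 ∧ dist y m = dist x y / 2 ∧
      ∀ z, dist z m ^ 2 ≤ dist z x ^ 2 / 2 + dist z y ^ 2 / 2 - dist x y ^ 2 / 4 := by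
  rcases eq_or_ne x y with rfl | hxy
  · exact ⟨x, by simp, by simp, fun z => by simp⟩
  obtain ⟨c, hc⟩ := hX.exists_geodesic x y
  have hpos : 0 < dist x y := dist_pos.2 hxy
  have h0 : (0 : ℝ) ∈ Set.Icc 0 (dist x y) := ⟨le_rfl, hpos.le⟩
  have h1 : dist x y ∈ Set.Icc 0 (dist x y) := ⟨hpos.le, le_rfl⟩
  have hm : dist x y / 2 ∈ Set.Icc 0 (dist x y) := ⟨by linarith, by linarith⟩
  refine ⟨c (dist x y / 2), ?_, ?_, fun z => ?_⟩
  · have h := hc.isometric 0 h0 _ hm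
    rwa [hc.source, zero_sub, abs_neg, abs_of_nonneg hm.1] at h
  · have h := hc.isometric _ h1 _ hm
    rwa [hc.target, sub_half, abs_of_nonneg hm.1] at h
  · obtain ⟨c', hc'⟩ := hX.exists_geodesic x z
    obtain ⟨x', y', z', hxy', hyz', hxz'⟩ := exists_comparison_triangle (a := dist x y)
      (b := dist x z) (c := dist y z) hpos dist_nonneg
      (by simpa [dist_comm z y] using dist_triangle x z y) (dist_triangle x y z)
      (by simpa [dist_comm y x] using dist_triangle y x z)
    have hthin := hX.thin x y z c c' hc hc' x' y' z' hxy' hyz' hxz' _ hm (dist x z)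
      ⟨dist_nonneg, le_rfl⟩ (midpoint ℝ x' y') (midpoint_mem_segment _ _) z'
      (right_mem_segment ℝ _ _) (by rw [dist_left_midpoint, hxy']; norm_num; ring) hxz'
    rw [hc'.target, dist_comm] at hthin
    -- In the plane the parallelogram law gives the median length exactly.
    have hpar := parallelogram_law_with_norm ℝ (z' - x') (z' - y')
    have e1 : z' - x' + (z' - y') = (2 : ℝ) • (z' - midpoint ℝ x' y') := by
      rw [midpoint_eq_smul_add, smul_sub, smul_smul]; norm_num [two_smul]; abel
    have e2 : z' - x' - (z' - y') = y' - x' := by abel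
    rw [e1, e2, norm_smul, ← dist_eq_norm, ← dist_eq_norm, ← dist_eq_norm, ← dist_eq_norm,
      dist_comm z' x', dist_comm z' y', dist_comm y' x', hxy', hyz', hxz',
      dist_comm z' (midpoint ℝ x' y')] at hpar
    rw [Real.norm_ofNat] at hpar
    have hsq := pow_le_pow_left₀ dist_nonneg hthin 2
    rw [dist_comm z x, dist_comm z y]
    nlinarith

/-- CAT(0) spaces have roundness two. -/
theorem dist_sq_add_dist_sq_le (hX : IsCAT0 X) (x y p q : X) :
    dist x p ^ 2 + dist y q ^ 2 ≤
      dist x q ^ 2 + dist y p ^ 2 + (dist x y ^ 2 + dist p q ^ 2) := by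
  -- With `m` the midpoint of one diagonal, CN at `y` and `q` bounds the other through `d(y,q)² ≤ 2
  -- d(y,m)² + 2 d(q,m)²`.
  obtain ⟨m, -, -, hm⟩ := hX.exists_midpoint x p
  have hy := hm y
  have hq := hm q
  have ht := dist_triangle y m q
  rw [dist_comm m q] at ht
  have h2 := pow_le_pow_left₀ dist_nonneg ht 2
  rw [dist_comm x q, dist_comm x y, dist_comm p q]
  nlinarith [sq_nonneg (dist y m - dist q m)]

end IsCAT0

/-! ### Translation lengths -/

section TranslationLength

variable {X : Type*} [MetricSpace X]

theorem bddBelow_range_dist_apply (γ : X ≃ᵢ X) : BddBelow (Set.range fun x => dist x (γ x)) :=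
  ⟨0, by rintro _ ⟨y, rfl⟩; exact dist_nonneg⟩

theorem translationLength_le (γ : X ≃ᵢ X) (x : X) : translationLength γ ≤ dist x (γ x) :=
  ciInf_le (bddBelow_range_dist_apply γ) x

theorem translationLength_nonneg (γ : X ≃ᵢ X) : 0 ≤ translationLength γ :=
  Real.iInf_nonneg fun _ => dist_nonneg

theorem translationLength_inv (γ : X ≃ᵢ X) : translationLength γ⁻¹ = translationLength γ := by
  refine (γ.toEquiv.iInf_congr fun x => ?_).symm
  change dist (γ x) (γ⁻¹ (γ x)) = dist x (γ x)
  rw [← IsometryEquiv.mul_apply, inv_mul_cancel, IsometryEquiv.coe_one, id, dist_comm]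

theorem translationLength_conj (γ e : X ≃ᵢ X) :
    translationLength (e * γ * e⁻¹) = translationLength γ := by
  refine (e.toEquiv.iInf_congr fun x => ?_).symm
  change dist (e x) ((e * γ * e⁻¹) (e x)) = dist x (γ x)
  rw [← IsometryEquiv.mul_apply, inv_mul_cancel_right, IsometryEquiv.mul_apply, e.dist_eq]

theorem isElliptic_or_isNeutralParabolic {γ : X ≃ᵢ X} (h : translationLength γ = 0) :
    IsElliptic γ ∨ IsNeutralParabolic γ :=
  (minSet γ).eq_empty_or_nonempty.symm.imp (⟨·, h⟩) (⟨·, h⟩)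

/-- In the triangle `x, γx, γ²x` the points `m` and `γm` are midpoints of two sides, and a midline
is at most half the base. -/
theorem IsCAT0.two_mul_translationLength_le [Nonempty X] (hX : IsCAT0 X) (γ : X ≃ᵢ X) :
    2 * translationLength γ ≤ translationLength (γ ^ 2) := by
  refine le_ciInf fun x => ?_
  obtain ⟨m, h1, h2, hm⟩ := hX.exists_midpoint x (γ x)
  have ha := hm (γ m)
  have hb := hm (γ⁻¹ x)
  have hγ : γ (γ⁻¹ x) = x := by
    rw [← IsometryEquiv.mul_apply, mul_inv_cancel, IsometryEquiv.coe_one, id]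
  rw [← γ.dist_eq (γ⁻¹ x) m, ← γ.dist_eq (γ⁻¹ x) x, ← γ.dist_eq (γ⁻¹ x) (γ x), hγ] at hb
  rw [γ.dist_eq, dist_comm m x, h1, dist_comm (γ m) x, dist_comm (γ m) m] at ha
  have hd : 2 * dist m (γ m) ≤ dist x (γ (γ x)) :=
    le_of_sq_le_sq (by nlinarith) dist_nonneg
  rw [pow_two, IsometryEquiv.mul_apply]
  linarith [translationLength_le γ m]

/-- Doubling gives the bound for powers of two. Fekete's lemma extends it to all `n`, since the
limit of a subadditive sequence over `n` is a lower bound for every term. -/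
theorem IsCAT0.mul_translationLength_le [Nonempty X] (hX : IsCAT0 X) (γ : X ≃ᵢ X) (x : X) (n : ℕ) :
    n * translationLength γ ≤ dist x ((γ ^ n) x) := by
  have hpow : ∀ k : ℕ, 2 ^ k * translationLength γ ≤ translationLength (γ ^ 2 ^ k) := by
    intro k
    induction k with
    | zero => simp
    | succ k ih =>
      have h := hX.two_mul_translationLength_le (γ ^ 2 ^ k)
      rw [← pow_mul, ← pow_succ] at h
      rw [pow_succ]
      linarith
  have hsub : Subadditive fun n => dist x ((γ ^ n) x) := fun m n => by
    have h := dist_triangle x ((γ ^ m) x) ((γ ^ (m + n)) x)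
    rw [pow_add, IsometryEquiv.mul_apply, (γ ^ m).dist_eq] at h
    simpa only [pow_add, IsometryEquiv.mul_apply] using h
  have hbdd : BddBelow (Set.range fun n : ℕ => dist x ((γ ^ n) x) / n) :=
    ⟨0, by rintro _ ⟨n, rfl⟩; positivity⟩
  rcases Nat.eq_zero_or_pos n with rfl | hn
  · simp
  have hlim : translationLength γ ≤ hsub.lim := by
    refine ge_of_tendsto' ((hsub.tendsto_lim hbdd).comp
      (tendsto_pow_atTop_atTop_of_one_lt (one_lt_two : 1 < 2))) fun k => ?_
    simp only [Function.comp_apply, Nat.cast_pow, Nat.cast_ofNat]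
    rw [le_div_iff₀ (by positivity), mul_comm]
    exact (hpow k).trans (translationLength_le _ x)
  have h := hlim.trans (hsub.lim_le_div hbdd hn.ne')
  rwa [le_div_iff₀ (by positivity), mul_comm] at h

end TranslationLength

/-! ### Isometries of positive translation length -/

section Centralizer

variable {X : Type*} [MetricSpace X]

/-- The displacement of `g` in the direction of `γ`, seen from `γ ^ n x`. -/
noncomputable def directionalDisplacement (γ : X ≃ᵢ X) (x : X) (g : X ≃ᵢ X) (n : ℕ) : ℝ :=
  -- If `γ` were translation by `v` in Euclidean space and `w = g x - x`, this would tend to `-2⟨w,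
  -- v⟩`.
  (dist (g x) ((γ ^ n) x) ^ 2 - dist x ((γ ^ n) x) ^ 2) / n

theorem dist_pow_apply_le (γ : X ≃ᵢ X) (x : X) (n : ℕ) :
    dist x ((γ ^ n) x) ≤ n * dist x (γ x) := by
  induction n with
  | zero => simp
  | succ n ih =>
    have h := dist_triangle x ((γ ^ n) x) ((γ ^ (n + 1)) x)
    rw [pow_succ, IsometryEquiv.mul_apply, (γ ^ n).dist_eq] at h
    rw [pow_succ, IsometryEquiv.mul_apply]
    push_cast
    linarith

theorem abs_directionalDisplacement_le (γ : X ≃ᵢ X) (x : X) (g : X ≃ᵢ X) (n : ℕ) :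
    |directionalDisplacement γ x g n| ≤
      dist x (g x) * (dist x (g x) + 2 * dist x (γ x)) := by
  rcases Nat.eq_zero_or_pos n with rfl | hn
  · simp only [directionalDisplacement, Nat.cast_zero, div_zero, abs_zero]
    positivity
  have hn1 : (1 : ℝ) ≤ n := by exact_mod_cast hn
  rw [directionalDisplacement, abs_div, Nat.abs_cast, div_le_iff₀ (by positivity), sq_sub_sq,
    abs_mul, abs_of_nonneg (by positivity), mul_comm]
  have h1 : |dist (g x) ((γ ^ n) x) - dist x ((γ ^ n) x)| ≤ dist x (g x) := by
    rw [dist_comm x (g x)]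
    exact abs_dist_sub_le _ _ _
  have h2 := dist_pow_apply_le γ x n
  have h3 : dist (g x) ((γ ^ n) x) + dist x ((γ ^ n) x) ≤
      (dist x (g x) + 2 * dist x (γ x)) * n := by
    have h4 := (abs_le.1 h1).2
    nlinarith [dist_nonneg (x := x) (y := g x)]
  rw [mul_assoc]
  exact mul_le_mul h1 h3 (by positivity) dist_nonneg

/-- As `g` commutes with `γ`, the defect is `1/n` times an alternating sum of squared sides and
diagonals for `x, h x, γ ^ n x, γ ^ n (g⁻¹ x)`. Roundness two, used in both orders, bounds that sum
independently of `n`. -/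
theorem IsCAT0.tendsto_directionalDisplacement_mul_sub (hX : IsCAT0 X) (γ : X ≃ᵢ X) (x : X)
    {g : X ≃ᵢ X} (hg : Commute g γ) (h : X ≃ᵢ X) :
    Filter.Tendsto (fun n => directionalDisplacement γ x (g * h) n -
      (directionalDisplacement γ x g n + directionalDisplacement γ x h n))
      Filter.atTop (nhds 0) := by
  refine squeeze_zero_norm (fun n => ?_) (tendsto_const_div_atTop_nhds_zero_nat
    (dist x (h x) ^ 2 + dist x (g⁻¹ x) ^ 2))
  have hmove : ∀ y, dist (g y) ((γ ^ n) x) = dist y ((γ ^ n) (g⁻¹ x)) := fun y => by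
    rw [← g.dist_eq y, ← IsometryEquiv.mul_apply g, (hg.pow_right n).eq,
      IsometryEquiv.mul_apply, ← IsometryEquiv.mul_apply g, mul_inv_cancel,
      IsometryEquiv.coe_one, id]
  have h1 := hX.dist_sq_add_dist_sq_le x (h x) ((γ ^ n) x) ((γ ^ n) (g⁻¹ x))
  have h2 := hX.dist_sq_add_dist_sq_le x (h x) ((γ ^ n) (g⁻¹ x)) ((γ ^ n) x)
  rw [(γ ^ n).dist_eq] at h1 h2
  rw [dist_comm (g⁻¹ x) x] at h2
  simp only [directionalDisplacement, IsometryEquiv.mul_apply, hmove]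
  rw [← add_div, ← sub_div, Real.norm_eq_abs, abs_div, Nat.abs_cast]
  gcongr
  rw [abs_le]
  constructor <;> linarith

/-- Otherwise `dist x (γ ^ n x) ^ 2` would eventually grow by less than `t² n` at each step, hence
only like `t² n² / 2`, against the lower bound `t² n²`. -/
theorem IsCAT0.frequently_directionalDisplacement_self_le [Nonempty X] (hX : IsCAT0 X)
    (γ : X ≃ᵢ X) (hγ : 0 < translationLength γ) (x : X) :
    ∃ᶠ n in Filter.atTop, directionalDisplacement γ x γ n ≤ -translationLength γ ^ 2 := by
  intro hev
  obtain ⟨N, hN⟩ := Filter.eventually_atTop.1 hev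
  set t := translationLength γ with ht
  set E : ℕ → ℝ := fun n => dist x ((γ ^ n) x) ^ 2 - t ^ 2 * ((n ^ 2 + n) / 2) with hE
  have hstep : ∀ n, N ≤ n → E (n + 1) ≤ E n := fun n hn => by
    have h := hN (n + 1) (by omega)
    rw [not_le, directionalDisplacement, pow_succ' γ, IsometryEquiv.mul_apply, γ.dist_eq,
      lt_div_iff₀ (by positivity)] at h
    simp only [hE]
    rw [pow_succ' γ, IsometryEquiv.mul_apply]
    push_cast at h ⊢
    nlinarith
  have hanti : ∀ n, N ≤ n → E n ≤ E N := fun n hn => by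
    induction n, hn using Nat.le_induction with
    | base => exact le_rfl
    | succ n hn ih => exact (hstep n hn).trans ih
  obtain ⟨m, hm⟩ := exists_nat_gt (E N / (t ^ 2 / 2))
  rw [div_lt_iff₀ (by positivity)] at hm
  set n := max N (m + 2)
  have hn := hanti n (le_max_left _ _)
  have hnm : (m : ℝ) + 2 ≤ n := by exact_mod_cast le_max_right N (m + 2)
  have hlow := pow_le_pow_left₀ (by positivity) (hX.mul_translationLength_le γ x n) 2
  rw [← ht] at hlow
  have hm0 : (0 : ℝ) ≤ m := m.cast_nonneg
  have : t ^ 2 / 2 * (n ^ 2 - n) ≤ E N := by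
    simp only [hE] at hn ⊢
    nlinarith
  have h2 : (m : ℝ) ≤ n ^ 2 - n := by nlinarith
  nlinarith [mul_le_mul_of_nonneg_left h2 (by positivity : 0 ≤ t ^ 2 / 2)]

/-- An isometry of positive translation length of a CAT(0) space is detected by a real-valued
homomorphism on its centralizer. -/
theorem IsCAT0.exists_centralizer_hom_ne_one [Nonempty X] (hX : IsCAT0 X) (γ : X ≃ᵢ X)
    (hγ : 0 < translationLength γ) :
    ∃ φ : Subgroup.centralizer {γ} →* Multiplicative ℝ,
      φ ⟨γ, Subgroup.mem_centralizer_singleton_iff.2 rfl⟩ ≠ 1 := by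
  obtain ⟨x⟩ := ‹Nonempty X›
  have hfreq := hX.frequently_directionalDisplacement_self_le γ hγ x
  set S := {n | directionalDisplacement γ x γ n ≤ -translationLength γ ^ 2}
  -- The sequences need not converge, so limits are taken along an ultrafilter that also contains
  -- `S`; this keeps the limit at `γ` negative.
  have : (Filter.atTop ⊓ Filter.principal S).NeBot := Filter.frequently_mem_iff_neBot.1 hfreq
  set U := Ultrafilter.of (Filter.atTop ⊓ Filter.principal S)
  have hU : (U : Filter ℕ) ≤ Filter.atTop := (Ultrafilter.of_le _).trans inf_le_left
  have hUS : ∀ᶠ n in (U : Filter ℕ), n ∈ S :=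
    (Ultrafilter.of_le _).trans inf_le_right (Filter.mem_principal_self S)
  have hlim : ∀ g : X ≃ᵢ X, ∃ a, Filter.Tendsto (directionalDisplacement γ x g) U (nhds a) := by
    intro g
    obtain ⟨a, -, ha⟩ := (isCompact_Icc (a := -(dist x (g x) * (dist x (g x) + 2 * dist x (γ x))))
      (b := dist x (g x) * (dist x (g x) + 2 * dist x (γ x)))).ultrafilter_le_nhds
      (U.map (directionalDisplacement γ x g)) (Filter.le_principal_iff.2
        (Filter.Eventually.of_forall (f := (U : Filter ℕ)) fun n => abs_le.1 (abs_directionalDisplacement_le γ x g n)))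
    exact ⟨a, ha⟩
  choose L hL using hlim
  have hadd : ∀ g h : X ≃ᵢ X, Commute g γ → L (g * h) = L g + L h := fun g h hg => by
    have h1 := (hX.tendsto_directionalDisplacement_mul_sub γ x hg h).mono_left hU
    have h2 := (hL (g * h)).sub ((hL g).add (hL h))
    exact sub_eq_zero.1 (tendsto_nhds_unique h2 h1)
  refine ⟨MonoidHom.mk' (fun g => Multiplicative.ofAdd (L g)) fun g h => ?_, ?_⟩
  · rw [← ofAdd_add, Subgroup.coe_mul, hadd g h (Subgroup.mem_centralizer_singleton_iff.1 g.2)]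
  · have hle : L γ ≤ -translationLength γ ^ 2 := le_of_tendsto (hL γ) hUS
    intro h0
    have h0' : L γ = 0 := h0
    nlinarith [sq_pos_of_pos hγ]

/-- If `γ` is a product of commutators of elements of its centralizer, then in every isometric
action on a CAT(0) space it has translation length zero. -/
theorem IsCAT0.translationLength_eq_zero_of_mem_commutator [Nonempty X] (hX : IsCAT0 X)
    {G : Type*} [Group G] (Φ : G →* (X ≃ᵢ X)) {γ : G}
    (hγ : γ ∈ ⁅Subgroup.centralizer {γ}, Subgroup.centralizer {γ}⁆) :
    translationLength (Φ γ) = 0 := by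
  by_contra hne
  obtain ⟨φ, hφ⟩ := hX.exists_centralizer_hom_ne_one (Φ γ)
    ((translationLength_nonneg _).lt_of_ne' hne)
  have hmap : (Subgroup.centralizer {γ}).map Φ ≤ Subgroup.centralizer {Φ γ} := by
    rintro _ ⟨g, hg, rfl⟩
    rw [Subgroup.mem_centralizer_singleton_iff, ← map_mul, ← map_mul,
      Subgroup.mem_centralizer_singleton_iff.1 hg]
  have hmem := Subgroup.commutator_mono hmap hmap
    (Subgroup.map_commutator _ _ Φ ▸ Subgroup.mem_map_of_mem Φ hγ)
  -- Pass to the commutator subgroup of the centralizer as a group, where `φ` is defined.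
  rw [← Subgroup.map_subtype_commutator] at hmem
  obtain ⟨g, hg, hgγ⟩ := hmem
  have hg' : g = ⟨Φ γ, Subgroup.mem_centralizer_singleton_iff.2 rfl⟩ := Subtype.ext hgγ
  exact hφ (hg' ▸ Abelianization.commutator_subset_ker φ hg)

end Centralizer

/-! ### Commutation relations between Nielsen generators -/

open scoped commutatorElement

theorem leftNielsen_apply_of {α : Type*} [DecidableEq α] (i j : α) (h : i ≠ j) (k : α) :
    leftNielsen i j h (FreeGroup.of k) =
      if k = i then FreeGroup.of j * FreeGroup.of i else FreeGroup.of k :=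
  FreeGroup.lift_apply_of

theorem rightNielsen_apply_of {α : Type*} [DecidableEq α] (i j : α) (h : i ≠ j) (k : α) :
    rightNielsen i j h (FreeGroup.of k) =
      if k = i then FreeGroup.of i * FreeGroup.of j else FreeGroup.of k :=
  FreeGroup.lift_apply_of

theorem leftNielsen_symm_apply_of {α : Type*} [DecidableEq α] (i j : α) (h : i ≠ j) (k : α) :
    (leftNielsen i j h).symm (FreeGroup.of k) =
      if k = i then (FreeGroup.of j)⁻¹ * FreeGroup.of i else FreeGroup.of k :=
  FreeGroup.lift_apply_of

theorem rightNielsen_symm_apply_of {α : Type*} [DecidableEq α] (i j : α) (h : i ≠ j) (k : α) :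
    (rightNielsen i j h).symm (FreeGroup.of k) =
      if k = i then FreeGroup.of i * (FreeGroup.of j)⁻¹ else FreeGroup.of k :=
  FreeGroup.lift_apply_of

theorem FreeGroup.mulAut_ext {α : Type*} {f g : MulAut (FreeGroup α)}
    (h : ∀ a, f (FreeGroup.of a) = g (FreeGroup.of a)) : f = g :=
  MulEquiv.toMonoidHom_injective (FreeGroup.ext_hom _ _ h)

/-- A left Nielsen generator of a free group of rank at least four is a product of commutators
of elements of its centralizer. -/
theorem leftNielsen_mem_commutator_centralizer {α : Type*} [DecidableEq α] {i j k l : α}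
    (hij : i ≠ j) (hik : i ≠ k) (hil : i ≠ l) (hjk : j ≠ k) (hjl : j ≠ l) (hkl : k ≠ l) :
    leftNielsen i j hij ∈ ⁅Subgroup.centralizer {leftNielsen i j hij},
      Subgroup.centralizer {leftNielsen i j hij}⁆ := by
  set C := Subgroup.centralizer {leftNielsen i j hij}
  have mem : ∀ g : MulAut (FreeGroup α),
      (∀ a, leftNielsen i j hij (g (FreeGroup.of a)) = g (leftNielsen i j hij (FreeGroup.of a))) →
      g ∈ C := fun g hg =>
    Subgroup.mem_centralizer_singleton_iff.2 (FreeGroup.mulAut_ext fun a => (hg a).symm)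
  -- Left and right multiplications of `a_i` commute. The next six automorphisms fix both `a_i` and
  -- `a_j`. `λ_ik` is not available: it does not commute with `λ_ij`.
  have hRik : rightNielsen i k hik ∈ C := mem _ fun a => by
    by_cases h1 : a = i <;> simp [leftNielsen_apply_of, rightNielsen_apply_of, *, Ne.symm, mul_assoc]
  have hRkj : rightNielsen k j hjk.symm ∈ C := mem _ fun a => by
    by_cases h1 : a = i <;> by_cases h2 : a = k <;>
      simp [leftNielsen_apply_of, rightNielsen_apply_of, *, Ne.symm]
  have hLkj : leftNielsen k j hjk.symm ∈ C := mem _ fun a => by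
    by_cases h1 : a = i <;> by_cases h2 : a = k <;>
      simp [leftNielsen_apply_of, *, Ne.symm]
  have hRlj : rightNielsen l j hjl.symm ∈ C := mem _ fun a => by
    by_cases h1 : a = i <;> by_cases h2 : a = l <;>
      simp [leftNielsen_apply_of, rightNielsen_apply_of, *, Ne.symm]
  have hLlj : leftNielsen l j hjl.symm ∈ C := mem _ fun a => by
    by_cases h1 : a = i <;> by_cases h2 : a = l <;>
      simp [leftNielsen_apply_of, *, Ne.symm]
  have hRkl : rightNielsen k l hkl ∈ C := mem _ fun a => by
    by_cases h1 : a = i <;> by_cases h2 : a = k <;>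
      simp [leftNielsen_apply_of, rightNielsen_apply_of, *, Ne.symm]
  have hLkl : leftNielsen k l hkl ∈ C := mem _ fun a => by
    by_cases h1 : a = i <;> by_cases h2 : a = k <;>
      simp [leftNielsen_apply_of, *, Ne.symm]
  -- conjugation of the free factor `⟨a_i, a_j, a_k⟩` by `a_k`, and by `a_j`
  obtain ⟨P, hP⟩ : ∃ P, P = leftNielsen i k hik * (rightNielsen i k hik)⁻¹ *
    (leftNielsen j k hjk * (rightNielsen j k hjk)⁻¹) := ⟨_, rfl⟩
  obtain ⟨Q, hQ⟩ : ∃ Q, Q = leftNielsen i j hij * (rightNielsen i j hij)⁻¹ *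
    (leftNielsen k j hjk.symm * (rightNielsen k j hjk.symm)⁻¹) := ⟨_, rfl⟩
  have P_of : ∀ a, P (FreeGroup.of a) = if a = i ∨ a = j
      then FreeGroup.of k * FreeGroup.of a * (FreeGroup.of k)⁻¹ else FreeGroup.of a := fun a => by
    by_cases h1 : a = i <;> by_cases h2 : a = j <;>
      simp [leftNielsen_apply_of, rightNielsen_symm_apply_of, *, Ne.symm, mul_assoc]
  have Q_of : ∀ a, Q (FreeGroup.of a) = if a = i ∨ a = k
      then FreeGroup.of j * FreeGroup.of a * (FreeGroup.of j)⁻¹ else FreeGroup.of a := fun a => by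
    by_cases h1 : a = i <;> by_cases h2 : a = k <;>
      simp [leftNielsen_apply_of, rightNielsen_symm_apply_of, *, Ne.symm, mul_assoc]
  have hPC : P ∈ C := mem _ fun a => by
    clear hP
    by_cases h1 : a = i <;> by_cases h2 : a = j <;>
      simp [leftNielsen_apply_of, *, Ne.symm, mul_assoc]
  -- On the factor `⟨a_i, a_j, a_k⟩`, `λ_kj` turns conjugation by `a_k` into conjugation by `a_j
  -- a_k`; dividing by `P` leaves conjugation by `a_j`.
  have hQ' : Q = ⁅leftNielsen k j hjk.symm, P⁆ := by
    clear hP hQ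
    rw [commutatorElement_def, eq_mul_inv_iff_mul_eq, eq_mul_inv_iff_mul_eq]
    refine FreeGroup.mulAut_ext fun a => ?_
    by_cases h1 : a = i <;> by_cases h2 : a = j <;> by_cases h3 : a = k <;>
      simp [leftNielsen_apply_of, *, Ne.symm, mul_assoc]
  have hRij' : rightNielsen i j hij = ⁅(rightNielsen k j hjk.symm)⁻¹, (rightNielsen i k hik)⁻¹⁆ := by
    rw [commutatorElement_def, inv_inv, inv_inv, mul_assoc, mul_assoc, eq_inv_mul_iff_mul_eq,
      eq_inv_mul_iff_mul_eq]
    refine FreeGroup.mulAut_ext fun a => ?_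
    by_cases h1 : a = i <;> by_cases h3 : a = k <;>
      simp [rightNielsen_apply_of, *, Ne.symm, mul_assoc]
  have hRkj' : rightNielsen k j hjk.symm =
      ⁅(rightNielsen l j hjl.symm)⁻¹, (rightNielsen k l hkl)⁻¹⁆ := by
    rw [commutatorElement_def, inv_inv, inv_inv, mul_assoc, mul_assoc, eq_inv_mul_iff_mul_eq,
      eq_inv_mul_iff_mul_eq]
    refine FreeGroup.mulAut_ext fun a => ?_
    by_cases h1 : a = k <;> by_cases h3 : a = l <;>
      simp [rightNielsen_apply_of, *, Ne.symm, mul_assoc]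
  have hLkj' : leftNielsen k j hjk.symm =
      ⁅(leftNielsen l j hjl.symm)⁻¹, (leftNielsen k l hkl)⁻¹⁆ := by
    rw [commutatorElement_def, inv_inv, inv_inv, mul_assoc, mul_assoc, eq_inv_mul_iff_mul_eq,
      eq_inv_mul_iff_mul_eq]
    refine FreeGroup.mulAut_ext fun a => ?_
    by_cases h1 : a = k <;> by_cases h3 : a = l <;>
      simp [leftNielsen_apply_of, *, Ne.symm, mul_assoc]
  have mQ : Q ∈ ⁅C, C⁆ := hQ' ▸ Subgroup.commutator_mem_commutator hLkj hPC
  have mRij : rightNielsen i j hij ∈ ⁅C, C⁆ :=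
    hRij' ▸ Subgroup.commutator_mem_commutator (inv_mem hRkj) (inv_mem hRik)
  have mRkj : rightNielsen k j hjk.symm ∈ ⁅C, C⁆ :=
    hRkj' ▸ Subgroup.commutator_mem_commutator (inv_mem hRlj) (inv_mem hRkl)
  have mLkj : leftNielsen k j hjk.symm ∈ ⁅C, C⁆ :=
    hLkj' ▸ Subgroup.commutator_mem_commutator (inv_mem hLlj) (inv_mem hLkl)
  -- Solve the definition of `Q` for `λ_ij`; every other factor is already in `⁅C, C⁆`.
  have key : leftNielsen i j hij =
      Q * (leftNielsen k j hjk.symm * (rightNielsen k j hjk.symm)⁻¹)⁻¹ * rightNielsen i j hij := by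
    rw [hQ, mul_inv_cancel_right, inv_mul_cancel_right]
  rw [key]
  exact mul_mem (mul_mem mQ (inv_mem (mul_mem mLkj (inv_mem mRkj)))) mRij

/-- Inverting the generator `a_i` conjugates `λ_ij⁻¹` to `ρ_ij`. -/
theorem exists_rightNielsen_eq_conj {α : Type*} [DecidableEq α] (i j : α) (h : i ≠ j) :
    ∃ e : MulAut (FreeGroup α), rightNielsen i j h = e * (leftNielsen i j h)⁻¹ * e⁻¹ := by
  let f : FreeGroup α →* FreeGroup α :=
    FreeGroup.lift fun k => if k = i then (FreeGroup.of i)⁻¹ else FreeGroup.of k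
  have hf : ∀ k, f (FreeGroup.of k) = if k = i then (FreeGroup.of i)⁻¹ else FreeGroup.of k :=
    fun k => FreeGroup.lift_apply_of
  have hff : f.comp f = MonoidHom.id _ := by
    ext k
    by_cases hk : k = i <;> simp [hf, hk]
  let e : MulAut (FreeGroup α) := f.toMulEquiv f hff hff
  have he : ∀ k, e (FreeGroup.of k) = if k = i then (FreeGroup.of i)⁻¹ else FreeGroup.of k := hf
  refine ⟨e, ?_⟩
  rw [eq_mul_inv_iff_mul_eq]
  refine FreeGroup.mulAut_ext fun a => ?_
  by_cases h1 : a = i <;> by_cases h2 : a = j <;>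
    simp [rightNielsen_apply_of, leftNielsen_symm_apply_of, *, Ne.symm]

theorem mainTheorem6 (n : ℕ) (hn : 6 ≤ n) (X : Type*) [MetricSpace X] [CompleteSpace X]
    [Nonempty X] (hX : IsCAT0 X) (Φ : MulAut (FreeGroup (Fin n)) →* (X ≃ᵢ X))
    (i j : Fin n) (hij : i ≠ j) :
    (translationLength (Φ (leftNielsen i j hij)) = 0 ∧
      (IsElliptic (Φ (leftNielsen i j hij)) ∨ IsNeutralParabolic (Φ (leftNielsen i j hij)))) ∧
    (translationLength (Φ (rightNielsen i j hij)) = 0 ∧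
      (IsElliptic (Φ (rightNielsen i j hij)) ∨
        IsNeutralParabolic (Φ (rightNielsen i j hij)))) := by
  obtain ⟨k, hk⟩ : ∃ k, k ∉ ({i, j} : Finset (Fin n)) :=
    Finset.exists_mem_notMem_of_card_lt_card (t := Finset.univ)
      (Finset.card_le_two.trans_lt (by rw [Finset.card_fin]; omega)) |>.imp fun _ h => h.2
  obtain ⟨l, hl⟩ : ∃ l, l ∉ ({i, j, k} : Finset (Fin n)) :=
    Finset.exists_mem_notMem_of_card_lt_card (t := Finset.univ)
      (Finset.card_le_three.trans_lt (by rw [Finset.card_fin]; omega)) |>.imp fun _ h => h.2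
  simp only [Finset.mem_insert, Finset.mem_singleton, not_or] at hk hl
  have hleft : translationLength (Φ (leftNielsen i j hij)) = 0 :=
    hX.translationLength_eq_zero_of_mem_commutator Φ
      (leftNielsen_mem_commutator_centralizer hij (Ne.symm hk.1) (Ne.symm hl.1) (Ne.symm hk.2)
        (Ne.symm hl.2.1) (Ne.symm hl.2.2))
  have hright : translationLength (Φ (rightNielsen i j hij)) = 0 := by
    obtain ⟨e, he⟩ := exists_rightNielsen_eq_conj i j hij
    rw [he, map_mul, map_mul, map_inv, map_inv, translationLength_conj, translationLength_inv,
      hleft]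
  exact ⟨⟨hleft, isElliptic_or_isNeutralParabolic hleft⟩,
    ⟨hright, isElliptic_or_isNeutralParabolic hright⟩⟩
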